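/- Let $0<p<1$ and $0<q<1$ with $(p,q)\neq(\tfrac12,\tfrac12)$. Let all the signs $\xi(i)$, $\eta(j)\in\{-1,1\}$ ($i,j\in\mathbb Z$) be independent, with $\mathbb P(\xi(i)=1)=q$ and $\mathbb P(\eta(j)=1)=p$. The vertical line $x=i$ is oriented to the North if $\xi(i)=1$ and to the South otherwise; the horizontal line $y=j$ is oriented to the West if $\eta(j)=1$ and to the East otherwise. The corner percolation graph has vertex set $\mathbb Z^2$ and the following open edges: the vertical edge $\{(i,k),(i,k+1)\}$ is open if and only if $i+k$ is odd when $\xi(i)=1$, and if and only if $i+k$ is even when $\xi(i)=-1$; the horizontal edge $\{(k,j),(k+1,j)\}$ is open if and only if $k+j$ is odd when $\eta(j)=1$, and if and only if $k+j$ is even when $\eta(j)=-1$. A *path* is a connected component of this graph, and an *infinite path* is a component that is the set of vertices of a bi-infinite simple path $(\gamma_n)_{n\in\mathbb Z}$ along open edges; such a $\gamma$ is called a parametrization of the component. The walk from the origin makes alternately horizontal and vertical unit steps, the first one being horizontal, and follows at each step the orientation of the line that it uses. Then: 1. With positive probability, the walk from the origin never returns to the origin and the component of the origin is an infinite path. 2.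 Almost surely, there are infinitely many infinite paths. 3. For $\varepsilon>0$ let $C^{\varepsilon}_{p,q}$ be the set of the $v\in\mathbb Z^2$ with $|\langle v,z\rangle|\le\varepsilon\,|z|\,|v|$, where $z=(2q-1,2p-1)$ (a double cone around the line $y=\frac{2q-1}{1-2p}x$ if $p\ne\frac12$, and around the vertical axis if $p=\frac12$). Almost surely, for every path $C$ and every $\varepsilon>0$ there is $R>0$ such that $C\subset D_R\cup C^{\varepsilon}_{p,q}$, where $D_R$ is the disk of radius $R$ around the origin. 4. Almost surely, for every infinite path and every parametrization $\gamma_n=(x_n,y_n)$ of it, the path has the following asymptotic slope both as $n\to+\infty$ and as $n\to-\infty$: if $p\neq\frac12$, then $x_n\ne0$ for all $|n|$ large enough and $y_n/x_n\to\frac{2q-1}{1-2p}$; if $p=\frac12$, then $y_n\ne0$ for all $|n|$ large enough and $x_n/y_n\to0$ (infinite slope). -/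

import Mathlib

open MeasureTheory Filter Topology

namespace CornerPercolation

/-- The environments `(ξ, η) ∈ {-1, 1}^ℤ × {-1, 1}^ℤ`, where `{-1, 1}` is the group `ℤˣ` of units.
`ξ i` is the sign of the vertical line `x = i` (`1` for North, `-1` for South) and `η j` is the
sign of the horizontal line `y = j` (`1` for West, `-1` for East). -/
abbrev Env : Type := (ℤ → ℤˣ) × (ℤ → ℤˣ)

/-- The law `r δ₁ + (1 - r) δ₋₁` of a single sign, for `0 ≤ r ≤ 1`. -/
noncomputable def signLaw (r : ℝ) : Measure ℤˣ :=
  ENNReal.ofReal r • Measure.dirac 1 + ENNReal.ofReal (1 - r) • Measure.dirac (-1)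

/-- The law of the environment: all the signs are independent, a vertical line is oriented to the
North with probability `q`, and a horizontal line is oriented to the West with probability `p`. -/
noncomputable def envLaw (p q : ℝ) : Measure Env :=
  (Measure.infinitePi fun _ : ℤ => signLaw q).prod (Measure.infinitePi fun _ : ℤ => signLaw p)

/-- The vertical edge `{(i, k), (i, k + 1)}` is open: `(i, k)` is odd if `ξ i = 1`, and even if
`ξ i = -1`. -/
def VertOpen (ω : Env) (i k : ℤ) : Prop :=
  (ω.1 i = 1 ∧ Odd (i + k)) ∨ (ω.1 i = -1 ∧ Even (i + k))

/-- The horizontal edge `{(k, j), (k + 1, j)}` is open: `(k, j)` is odd if `η j = 1`, and even if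
`η j = -1`. -/
def HorizOpen (ω : Env) (k j : ℤ) : Prop :=
  (ω.2 j = 1 ∧ Odd (k + j)) ∨ (ω.2 j = -1 ∧ Even (k + j))

/-- The corner percolation graph of the environment `ω`: the vertices are the points of `ℤ²`, the
edges are the open ones. -/
def graph (ω : Env) : SimpleGraph (ℤ × ℤ) :=
  SimpleGraph.fromRel fun u v =>
    (v = (u.1 + 1, u.2) ∧ HorizOpen ω u.1 u.2) ∨ (v = (u.1, u.2 + 1) ∧ VertOpen ω u.1 u.2)

/-- The walk that starts from the origin with a horizontal step and then takes alternately vertical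
and horizontal steps, each step following the orientation of the line it uses. -/
def walk (ω : Env) : ℕ → ℤ × ℤ
  | 0 => (0, 0)
  | n + 1 =>
    if Even n then ((walk ω n).1 - (ω.2 (walk ω n).2 : ℤ), (walk ω n).2)
    else ((walk ω n).1, (walk ω n).2 + (ω.1 (walk ω n).1 : ℤ))

/-- `γ` runs through the connected component `C` as a bi-infinite simple path. -/
def IsBiinfinitePath {ω : Env} (C : (graph ω).ConnectedComponent) (γ : ℤ → ℤ × ℤ) : Prop :=
  Function.Injective γ ∧ (∀ n, (graph ω).Adj (γ n) (γ (n + 1))) ∧ Set.range γ = C.supp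

/-- The set of infinite paths: the connected components that are bi-infinite simple paths. -/
def infinitePaths (ω : Env) : Set (graph ω).ConnectedComponent :=
  {C | ∃ γ, IsBiinfinitePath C γ}

/-- The vertices of `ℤ²` in the disk of radius `R` around the origin. -/
def disk (R : ℝ) : Set (ℤ × ℤ) :=
  {v | √((v.1 : ℝ) ^ 2 + (v.2 : ℝ) ^ 2) ≤ R}

/-- The discrete double cone of the vertices `v` such that `|⟨v / |v|, z / |z|⟩| ≤ ε` (or `v = 0`),
where `z = (2q - 1, 2p - 1)` is orthogonal to the line through the origin directed by
`(1 - 2p, 2q - 1)`. This line is the axis of the cone. -/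
def cone (p q ε : ℝ) : Set (ℤ × ℤ) :=
  {v | |(2 * q - 1) * (v.1 : ℝ) + (2 * p - 1) * (v.2 : ℝ)| ≤
    ε * √((2 * q - 1) ^ 2 + (2 * p - 1) ^ 2) * √((v.1 : ℝ) ^ 2 + (v.2 : ℝ) ^ 2)}

/-- Along the filter `l`, the path `γ` has the asymptotic slope `s`. -/
def HasSlope (γ : ℤ → ℤ × ℤ) (l : Filter ℤ) (s : ℝ) : Prop :=
  (∀ᶠ n in l, (γ n).1 ≠ 0) ∧ Tendsto (fun n => ((γ n).2 : ℝ) / ((γ n).1 : ℝ)) l (𝓝 s)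

/-- Along the filter `l`, the path `γ` has an infinite asymptotic slope: the inverse `x / y` of
the slope tends to `0`. -/
def HasInfiniteSlope (γ : ℤ → ℤ × ℤ) (l : Filter ℤ) : Prop :=
  (∀ᶠ n in l, (γ n).2 ≠ 0) ∧ Tendsto (fun n => ((γ n).1 : ℝ) / ((γ n).2 : ℝ)) l (𝓝 0)

end CornerPercolation

namespace CornerPercolation

/-- The step of the oriented walk: horizontal from the even vertices, vertical from the odd ones. -/
def step (ω : Env) : Equiv.Perm (ℤ × ℤ) where
  toFun v := if Even (v.1 + v.2) then (v.1 - (ω.2 v.2 : ℤ), v.2) else (v.1, v.2 + (ω.1 v.1 : ℤ))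
  invFun v := if Even (v.1 + v.2) then (v.1, v.2 - (ω.1 v.1 : ℤ)) else (v.1 + (ω.2 v.2 : ℤ), v.2)
  left_inv := by
    rintro ⟨x, y⟩
    rcases Int.units_eq_one_or (ω.1 x) with h | h <;>
    rcases Int.units_eq_one_or (ω.2 y) with h' | h' <;>
    by_cases hp : Even (x + y) <;> simp [h, h', hp, ← add_assoc, ← add_sub_assoc, sub_add_eq_add_sub,
      ← sub_eq_add_neg, add_right_comm x 1 y]
  right_inv := by
    rintro ⟨x, y⟩
    rcases Int.units_eq_one_or (ω.1 x) with h | h <;>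
    rcases Int.units_eq_one_or (ω.2 y) with h' | h' <;>
    by_cases hp : Even (x + y) <;> simp [h, h', hp, ← add_assoc, ← add_sub_assoc, sub_add_eq_add_sub,
      ← sub_eq_add_neg, add_right_comm x 1 y]

lemma step_of_even {ω : Env} {v : ℤ × ℤ} (h : Even (v.1 + v.2)) :
    step ω v = (v.1 - (ω.2 v.2 : ℤ), v.2) := if_pos h

lemma step_of_not_even {ω : Env} {v : ℤ × ℤ} (h : ¬ Even (v.1 + v.2)) :
    step ω v = (v.1, v.2 + (ω.1 v.1 : ℤ)) := if_neg h

lemma adj_step (ω : Env) (v : ℤ × ℤ) : (graph ω).Adj v (step ω v) := by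
  obtain ⟨x, y⟩ := v
  rw [graph, SimpleGraph.fromRel_adj]
  by_cases hp : Even (x + y)
  · rw [step_of_even hp]
    rcases Int.units_eq_one_or (ω.2 y) with h | h <;>
      simp [h, HorizOpen, VertOpen, hp, sub_add_eq_add_sub]
    omega
  · rw [step_of_not_even hp]
    rcases Int.units_eq_one_or (ω.1 x) with h | h <;>
      simp [h, HorizOpen, VertOpen, hp, ← sub_eq_add_neg, ← add_sub_assoc]
    · exact Or.inl (by simpa using hp)
    · exact ⟨by omega, by simpa using hp⟩

lemma eq_step_of_adj {ω : Env} {u v : ℤ × ℤ} (h : (graph ω).Adj u v) :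
    v = step ω u ∨ u = step ω v := by
  rw [graph, SimpleGraph.fromRel_adj] at h
  have key : ∀ u v : ℤ × ℤ, (v = (u.1 + 1, u.2) ∧ HorizOpen ω u.1 u.2) ∨
      (v = (u.1, u.2 + 1) ∧ VertOpen ω u.1 u.2) → v = step ω u ∨ u = step ω v := by
    rintro ⟨x, y⟩ v (⟨rfl, ⟨h, hp⟩ | ⟨h, hp⟩⟩ | ⟨rfl, ⟨h, hp⟩ | ⟨h, hp⟩⟩)
    · right
      rw [step_of_even (by simp only at hp ⊢; grind)]
      simp_all
    · left
      rw [step_of_even hp]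
      simp_all
    · left
      rw [step_of_not_even (by simpa using hp)]
      simp_all
    · right
      rw [step_of_not_even (by simp only at hp ⊢; grind)]
      simp_all
  rcases h.2 with h | h
  · exact key u v h
  · exact (key v u h).symm

lemma reachable_zpow_step (ω : Env) (v : ℤ × ℤ) (n : ℤ) :
    (graph ω).Reachable v ((step ω ^ n) v) := by
  induction n with
  | zero => simp
  | succ n ih =>
    rw [zpow_add_one, Equiv.Perm.mul_apply, ← Equiv.Perm.mul_apply, ← zpow_add_one, add_comm,
      zpow_add, zpow_one, Equiv.Perm.mul_apply]
    exact ih.trans (adj_step ω _).reachable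
  | pred n ih =>
    refine ih.trans ?_
    have h := adj_step ω ((step ω ^ (-(n : ℤ) - 1)) v)
    rw [← Equiv.Perm.mul_apply, ← zpow_one_add, add_sub_cancel] at h
    exact h.symm.reachable

lemma exists_zpow_of_reachable {ω : Env} {u v : ℤ × ℤ} (h : (graph ω).Reachable u v) :
    ∃ n : ℤ, (step ω ^ n) u = v := by
  obtain ⟨w⟩ := h
  induction w with
  | nil => exact ⟨0, rfl⟩
  | cons h _ ih =>
    obtain ⟨n, rfl⟩ := ih
    rcases eq_step_of_adj h with rfl | rfl
    · exact ⟨n + 1, by rw [zpow_add_one, Equiv.Perm.mul_apply]⟩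
    · exact ⟨n - 1, by rw [← Equiv.Perm.mul_apply, ← zpow_add_one, sub_add_cancel]⟩

/-- The orbit of `v` under the walk is infinite. -/
def Escapes (ω : Env) (v : ℤ × ℤ) : Prop := ∀ n : ℕ, 1 ≤ n → (step ω ^ n) v ≠ v

lemma Escapes.injective {ω : Env} {v : ℤ × ℤ} (h : Escapes ω v) :
    Function.Injective fun n : ℤ => (step ω ^ n) v := by
  have key : ∀ m n : ℤ, m < n → (step ω ^ m) v ≠ (step ω ^ n) v := by
    intro m n hmn e
    refine h (n - m).toNat (by omega) ?_
    rw [← zpow_natCast, Int.toNat_of_nonneg (by omega), sub_eq_neg_add, zpow_add,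
      Equiv.Perm.mul_apply, ← e, ← Equiv.Perm.mul_apply, ← zpow_add]
    simp
  intro m n e
  rcases lt_trichotomy m n with hl | hl | hl
  · exact absurd e (key _ _ hl)
  · exact hl
  · exact absurd e.symm (key _ _ hl)

lemma Escapes.mem_infinitePaths {ω : Env} {v : ℤ × ℤ} (h : Escapes ω v) :
    (graph ω).connectedComponentMk v ∈ infinitePaths ω := by
  refine ⟨fun n => (step ω ^ n) v, h.injective, fun n => ?_, ?_⟩
  · have := adj_step ω ((step ω ^ n) v)
    rwa [← Equiv.Perm.mul_apply, ← zpow_one_add, add_comm] at this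
  · ext u
    rw [SimpleGraph.ConnectedComponent.mem_supp_iff, SimpleGraph.ConnectedComponent.eq]
    constructor
    · rintro ⟨n, rfl⟩
      exact (reachable_zpow_step ω v n).symm
    · intro hu
      exact exists_zpow_of_reachable hu.symm

lemma Escapes.step_apply {ω : Env} {v : ℤ × ℤ} (h : Escapes ω v) : Escapes ω (step ω v) := by
  intro n hn e
  refine h n hn ((step ω).injective ?_)
  rwa [← Equiv.Perm.mul_apply, ← pow_succ', pow_succ, Equiv.Perm.mul_apply]

lemma even_step_iff (ω : Env) (v : ℤ × ℤ) :
    Even ((step ω v).1 + (step ω v).2) ↔ ¬ Even (v.1 + v.2) := by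
  obtain ⟨x, y⟩ := v
  by_cases hp : Even (x + y)
  · rw [step_of_even hp]
    rcases Int.units_eq_one_or (ω.2 y) with h | h <;> simp only [h] <;> push_cast <;> grind
  · rw [step_of_not_even hp]
    rcases Int.units_eq_one_or (ω.1 x) with h | h <;> simp only [h] <;> push_cast <;> grind

lemma walk_eq_step_pow (ω : Env) (n : ℕ) :
    walk ω n = (step ω ^ n) (0, 0) ∧ (Even ((walk ω n).1 + (walk ω n).2) ↔ Even n) := by
  induction n with
  | zero => simp [walk]
  | succ n ih =>
    have h : walk ω (n + 1) = step ω (walk ω n) := by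
      rw [walk]
      by_cases hn : Even n
      · rw [if_pos hn, step_of_even (ih.2.2 hn)]
      · rw [if_neg hn, step_of_not_even (mt ih.2.1 hn)]
    rw [h, even_step_iff, ih.2, Nat.even_add_one, pow_succ', Equiv.Perm.mul_apply, ih.1]
    exact ⟨rfl, Iff.rfl⟩

/-- The two-sided partial sums of a sequence of signs. -/
def signSum (ξ : ℤ → ℤˣ) : ℤ → ℤ
  | Int.ofNat n => ∑ k ∈ Finset.range n, (ξ k : ℤ)
  | Int.negSucc n => -∑ k ∈ Finset.range (n + 1), (ξ (-(k : ℤ) - 1) : ℤ)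

lemma signSum_natCast (ξ : ℤ → ℤˣ) (n : ℕ) :
    signSum ξ n = ∑ k ∈ Finset.range n, (ξ k : ℤ) := rfl

lemma signSum_neg_natCast (ξ : ℤ → ℤˣ) (n : ℕ) :
    signSum ξ (-n) = -∑ k ∈ Finset.range n, (ξ (-(k : ℤ) - 1) : ℤ) := by
  cases n with
  | zero => rfl
  | succ n => rfl

lemma signSum_add_one (ξ : ℤ → ℤˣ) (i : ℤ) : signSum ξ (i + 1) = signSum ξ i + ξ i := by
  obtain ⟨n, rfl | rfl⟩ := i.eq_nat_or_neg
  · exact_mod_cast Finset.sum_range_succ _ n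
  · cases n with
    | zero => simp [signSum]
    | succ n =>
      have h₁ : -((n + 1 : ℕ) : ℤ) + 1 = -(n : ℤ) := by push_cast; ring
      have h₂ : -((n + 1 : ℕ) : ℤ) = -(n : ℤ) - 1 := by push_cast; ring
      rw [h₁, signSum_neg_natCast, signSum_neg_natCast, Finset.sum_range_succ, h₂]
      ring_nf

lemma even_signSum_add (ξ : ℤ → ℤˣ) (i : ℤ) : Even (signSum ξ i + i) := by
  have h : ∀ i, Even (signSum ξ (i + 1) + (i + 1)) ↔ Even (signSum ξ i + i) := by
    intro i
    rw [signSum_add_one]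
    rcases Int.units_eq_one_or (ξ i) with h | h <;> simp only [h] <;> push_cast <;> grind
  induction i with
  | zero => simp [show signSum ξ 0 = 0 from rfl]
  | succ n ih => exact (h n).2 ih
  | pred n ih => exact (h (-(n : ℤ) - 1)).1 (by rwa [sub_add_cancel])

/-- Twice the height of a vertex, which is constant along the paths. -/
def height (ω : Env) (v : ℤ × ℤ) : ℤ :=
  2 * signSum ω.1 v.1 + 2 * signSum ω.2 v.2 + ω.1 v.1 + ω.2 v.2 -
    (if Even (v.1 + v.2) then 1 else -1) * (ω.1 v.1 * ω.2 v.2)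

lemma height_step (ω : Env) (v : ℤ × ℤ) : height ω (step ω v) = height ω v := by
  have hs := even_step_iff ω v
  rw [height, height]
  obtain ⟨x, y⟩ := v
  by_cases hp : Even (x + y)
  · have hp' : ¬ Even ((step ω (x, y)).1 + (step ω (x, y)).2) := fun h => hs.1 h hp
    rw [if_pos hp, if_neg hp', step_of_even hp]
    dsimp only
    rcases Int.units_eq_one_or (ω.2 y) with h | h
    · have := signSum_add_one ω.1 (x - 1)
      rw [sub_add_cancel] at this
      rw [h, Units.val_one, this]; ring
    · have := signSum_add_one ω.1 x
      rw [h, Units.val_neg, Units.val_one, sub_neg_eq_add, this]; ring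
  · have hp' := hs.2 hp
    rw [if_neg hp, if_pos hp', step_of_not_even hp]
    dsimp only
    rcases Int.units_eq_one_or (ω.1 x) with h | h
    · have := signSum_add_one ω.2 y
      rw [h, Units.val_one, this]; ring
    · have := signSum_add_one ω.2 (y - 1)
      rw [sub_add_cancel] at this
      rw [h, Units.val_neg, Units.val_one, ← sub_eq_add_neg, this]; ring

lemma height_zpow_step (ω : Env) (v : ℤ × ℤ) (n : ℤ) :
    height ω ((step ω ^ n) v) = height ω v := by
  induction n with
  | zero => simp
  | succ n ih => rw [add_comm, zpow_one_add, Equiv.Perm.mul_apply, height_step, ih]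
  | pred n ih =>
    rw [← height_step, ← Equiv.Perm.mul_apply, ← zpow_one_add, add_sub_cancel, ih]

lemma height_eq_of_reachable {ω : Env} {u v : ℤ × ℤ} (h : (graph ω).Reachable u v) :
    height ω v = height ω u := by
  obtain ⟨n, rfl⟩ := exists_zpow_of_reachable h
  exact height_zpow_step ω u n

lemma abs_height_sub_le (ω : Env) (v : ℤ × ℤ) :
    |height ω v - 2 * (signSum ω.1 v.1 + signSum ω.2 v.2)| ≤ 3 := by
  rw [height]
  rcases Int.units_eq_one_or (ω.1 v.1) with h | h <;>
  rcases Int.units_eq_one_or (ω.2 v.2) with h' | h' <;>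
  simp only [h, h'] <;> split_ifs <;> rw [abs_le] <;> constructor <;> push_cast <;> linarith

lemma step_swap (ω : Env) (v : ℤ × ℤ) :
    step ω.swap (step ω v).swap = v.swap := by
  have hs := even_step_iff ω v
  obtain ⟨x, y⟩ := v
  by_cases hp : Even (x + y)
  · have hp' : ¬ Even ((step ω (x, y)).1 + (step ω (x, y)).2) := fun h => hs.1 h hp
    rw [step_of_not_even (by rwa [add_comm])]
    rw [step_of_even hp]
    simp
  · have hp' := hs.2 hp
    rw [step_of_even (by rwa [add_comm])]
    rw [step_of_not_even hp]
    simp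

lemma Escapes.of_swap {ω : Env} {v : ℤ × ℤ} (h : Escapes ω.swap v) : Escapes ω v.swap := by
  intro n hn e
  refine h n hn ?_
  have key : ∀ (n : ℕ) (u : ℤ × ℤ), (step ω.swap ^ n) ((step ω ^ n) u).swap = u.swap := by
    intro n
    induction n with
    | zero => simp
    | succ n ih =>
      intro u
      rw [pow_succ' (step ω), pow_succ, Equiv.Perm.mul_apply, Equiv.Perm.mul_apply, step_swap, ih]
  have := key n v.swap
  rwa [e, Prod.swap_swap] at this

lemma height_swap (ω : Env) (v : ℤ × ℤ) : height ω.swap v.swap = height ω v := by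
  simp only [height, Prod.fst_swap, Prod.snd_swap, add_comm v.2 v.1]
  ring

/-- The odd vertex of the column `i` that is on one of the rows `0` and `1`. -/
def rowVertex (i : ℤ) : ℤ × ℤ := (i, if Even i then 1 else 0)

/-- The signed number of crossings from the half-plane `y ≤ 0` to the half-plane `y ≥ 1` in the
step from `v`. -/
def crossing (ω : Env) (v : ℤ × ℤ) : ℤ :=
  (if 1 ≤ (step ω v).2 then 1 else 0) - (if 1 ≤ v.2 then 1 else 0)

lemma crossing_eq_zero {ω : Env} {v : ℤ × ℤ} (h : v ≠ rowVertex v.1) : crossing ω v = 0 := by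
  obtain ⟨x, y⟩ := v
  rw [crossing]
  by_cases hp : Even (x + y)
  · rw [step_of_even hp, sub_self]
  · rw [step_of_not_even hp]
    simp only [rowVertex, ne_eq, Prod.mk.injEq, true_and] at h
    rcases Int.units_eq_one_or (ω.1 x) with h' | h' <;> simp only [h'] <;> push_cast <;> grind

lemma crossing_rowVertex (ω : Env) (m i : ℤ) :
    (if 2 * m ≤ signSum ω.1 (i + 1) then 1 else 0) - (if 2 * m ≤ signSum ω.1 i then 1 else 0) =
      if height ω (rowVertex i) = 4 * m - 1 + 2 * ω.2 0 then crossing ω (rowVertex i) else 0 := by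
  have he := even_signSum_add ω.1 i
  have h0 : signSum ω.2 0 = 0 := rfl
  have h1 : signSum ω.2 1 = ω.2 0 := by simpa [h0] using signSum_add_one ω.2 0
  rw [signSum_add_one, crossing, height]
  by_cases hi : Even i
  · have hr : rowVertex i = (i, 1) := by simp [rowVertex, hi]
    have hn : ¬ Even (i + 1) := by simpa [Int.even_add_one] using hi
    rw [hr, step_of_not_even hn, if_neg hn, h1]
    rcases Int.units_eq_one_or (ω.1 i) with h' | h' <;>
    rcases Int.units_eq_one_or (ω.2 1) with h'' | h'' <;> simp only [h', h''] <;> push_cast <;> grind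
  · have hr : rowVertex i = (i, 0) := by simp [rowVertex, hi]
    have hn : ¬ Even (i + 0) := by simpa using hi
    rw [hr, step_of_not_even hn, if_neg hn, h0]
    rcases Int.units_eq_one_or (ω.1 i) with h' | h' <;>
    rcases Int.units_eq_one_or (ω.2 0) with h'' | h'' <;> simp only [h', h''] <;> push_cast <;> grind

lemma finite_orbit {ω : Env} {v : ℤ × ℤ} (h : ¬ Escapes ω v) :
    (Set.range fun n : ℤ => (step ω ^ n) v).Finite := by
  simp only [Escapes, not_forall, not_not] at h
  obtain ⟨n, hn, e⟩ := h
  refine ((Set.finite_Ico (0 : ℤ) n).image fun k => (step ω ^ k) v).subset ?_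
  rintro _ ⟨k, rfl⟩
  refine ⟨k % n, ⟨Int.emod_nonneg _ (by omega), Int.emod_lt_of_pos _ (by omega)⟩, ?_⟩
  have key : (step ω ^ (n * (k / n))) v = v := by
    rw [zpow_mul, zpow_natCast]
    exact Equiv.Perm.zpow_apply_eq_self_of_apply_eq_self e _
  dsimp only
  conv_rhs => rw [← Int.emod_add_mul_ediv k n, zpow_add, Equiv.Perm.mul_apply, key]

lemma sum_crossing_eq_zero {ω : Env} {V : Finset (ℤ × ℤ)} (h : ∀ v, step ω v ∈ V ↔ v ∈ V) :
    ∑ v ∈ V, crossing ω v = 0 := by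
  simp only [crossing, Finset.sum_sub_distrib, sub_eq_zero]
  exact Finset.sum_equiv (step ω) (fun v => (h v).symm) fun _ _ => rfl

/-- If the partial sums of the vertical signs go to infinity in opposite directions on both sides,
then the walk escapes from some vertex of each level. -/
lemma exists_escapes {ω : Env} (m : ℤ) (N : ℕ)
    (hN : ¬ ((2 * m ≤ signSum ω.1 N) ↔ (2 * m ≤ signSum ω.1 (-N))))
    (hpos : ∀ i : ℤ, N ≤ i → (2 * m ≤ signSum ω.1 i ↔ 2 * m ≤ signSum ω.1 N))
    (hneg : ∀ i : ℤ, i ≤ -N → (2 * m ≤ signSum ω.1 i ↔ 2 * m ≤ signSum ω.1 (-N))) :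
    ∃ v, Escapes ω v ∧ height ω v = 4 * m - 1 + 2 * ω.2 0 := by
  by_contra! hcon
  set h := 4 * m - 1 + 2 * (ω.2 0 : ℤ) with hh
  let g : ℤ → ℤ := fun i => if 2 * m ≤ signSum ω.1 i then 1 else 0
  let J : Finset ℤ := (Finset.range (2 * N)).image fun k : ℕ => (k : ℤ) - N
  have hJ : ∀ i, i ∉ J → g (i + 1) - g i = 0 := by
    intro i hi
    rw [sub_eq_zero]
    rcases lt_or_ge i (-N) with h1 | h1
    · simp only [g, hneg i h1.le, hneg (i + 1) (by omega)]
    rcases lt_or_ge i N with h2 | h2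
    · exact absurd (Finset.mem_image.2 ⟨(i + N).toNat, by simp; omega, by omega⟩) hi
    · simp only [g, hpos i h2, hpos (i + 1) (by omega)]
  have hsum : ∑ i ∈ J, (g (i + 1) - g i) ≠ 0 := by
    rw [Finset.sum_image (fun a _ b _ hab => by simpa using hab)]
    have := Finset.sum_range_sub (fun k : ℕ => g ((k : ℤ) - N)) (2 * N)
    have e : ∀ k : ℕ, ((k + 1 : ℕ) : ℤ) - N = (k : ℤ) - N + 1 := fun k => by push_cast; ring
    simp only [e] at this
    rw [this]
    have e1 : ((2 * N : ℕ) : ℤ) - N = N := by push_cast; ring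
    have e2 : ((0 : ℕ) : ℤ) - N = -N := by simp
    rw [e1, e2]
    simp only [g]
    split_ifs <;> simp_all
  have hV : {v | ∃ i ∈ J, height ω (rowVertex i) = h ∧
      v ∈ Set.range fun n : ℤ => (step ω ^ n) (rowVertex i)}.Finite := by
    have : {v | ∃ i ∈ J, height ω (rowVertex i) = h ∧
      v ∈ Set.range fun n : ℤ => (step ω ^ n) (rowVertex i)} ⊆
        ⋃ i ∈ {i ∈ J | height ω (rowVertex i) = h},
          Set.range fun n : ℤ => (step ω ^ n) (rowVertex i) := by
      rintro v ⟨i, hi, hi', hv⟩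
      simp only [Set.mem_iUnion]
      exact ⟨i, by simp [hi, hi'], hv⟩
    refine Set.Finite.subset (Set.Finite.biUnion (Finset.finite_toSet _) fun i hi => ?_) this
    refine finite_orbit fun he => hcon _ he ?_
    simpa using (Finset.mem_filter.1 hi).2
  set V := hV.toFinset with hVdef
  have hVh : ∀ v ∈ V, height ω v = h := by
    intro v hv
    obtain ⟨i, -, hi, n, rfl⟩ := hV.mem_toFinset.1 hv
    rw [← hi]
    exact height_zpow_step _ _ _
  have hVs : ∀ v, step ω v ∈ V ↔ v ∈ V := by
    intro v
    simp only [hVdef, hV.mem_toFinset, Set.mem_ofPred_eq]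
    refine exists_congr fun i => and_congr_right fun _ => and_congr_right fun _ => ?_
    constructor
    · rintro ⟨n, e⟩
      refine ⟨n - 1, (step ω).injective ?_⟩
      dsimp only at e ⊢
      rw [← Equiv.Perm.mul_apply, ← zpow_one_add, add_sub_cancel, e]
    · rintro ⟨n, rfl⟩
      exact ⟨1 + n, by dsimp only; rw [zpow_one_add, Equiv.Perm.mul_apply]⟩
  let e : ℤ × ℤ → ℤ := fun v => if height ω v = h then crossing ω v else 0
  have h1 : ∑ v ∈ V, e v = 0 := by
    rw [← sum_crossing_eq_zero hVs]
    exact Finset.sum_congr rfl fun v hv => if_pos (hVh v hv)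
  have h2 : ∑ v ∈ J.image rowVertex ∪ V, e v = ∑ v ∈ V, e v := by
    refine (Finset.sum_subset Finset.subset_union_right fun v hv hv' => ?_).symm
    rcases Finset.mem_union.1 hv with hv | hv
    · obtain ⟨i, hi, rfl⟩ := Finset.mem_image.1 hv
      by_contra hne
      have : height ω (rowVertex i) = h := by
        by_contra h'
        exact hne (if_neg h')
      exact hv' (hV.mem_toFinset.2 ⟨i, hi, this, 0, rfl⟩)
    · exact absurd hv hv'
  have h3 : ∑ v ∈ J.image rowVertex ∪ V, e v = ∑ v ∈ J.image rowVertex, e v := by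
    refine (Finset.sum_subset Finset.subset_union_left fun v hv hv' => ?_).symm
    by_cases hr : v = rowVertex v.1
    · have hn : v.1 ∉ J := fun hJ => hv' (Finset.mem_image.2 ⟨v.1, hJ, hr.symm⟩)
      have := crossing_rowVertex ω m v.1
      rw [← hr] at this
      exact this.symm.trans (hJ _ hn)
    · simp only [e, crossing_eq_zero hr, ite_self]
  rw [Finset.sum_image (fun a _ b _ hab => congrArg Prod.fst hab)] at h3
  refine hsum ?_
  rw [← h1, ← h2, h3]
  exact Finset.sum_congr rfl fun i _ => crossing_rowVertex ω m i

/-- The partial sums go to infinity in opposite directions on both sides. -/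
def HasDrift (ξ : ℤ → ℤˣ) : Prop :=
  (Tendsto (signSum ξ) atTop atTop ∧ Tendsto (signSum ξ) atBot atBot) ∨
    (Tendsto (signSum ξ) atTop atBot ∧ Tendsto (signSum ξ) atBot atTop)

lemma HasDrift.exists_escapes {ω : Env} (h : HasDrift ω.1) (m : ℤ) :
    ∃ v, Escapes ω v ∧ height ω v = 4 * m - 1 + 2 * ω.2 0 := by
  have key : ∃ N : ℕ, ((∀ i : ℤ, N ≤ i → 2 * m ≤ signSum ω.1 i) ∧
        ∀ i : ℤ, i ≤ -N → ¬ 2 * m ≤ signSum ω.1 i) ∨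
      ((∀ i : ℤ, N ≤ i → ¬ 2 * m ≤ signSum ω.1 i) ∧ ∀ i : ℤ, i ≤ -N → 2 * m ≤ signSum ω.1 i) := by
    rcases h with ⟨h1, h2⟩ | ⟨h1, h2⟩
    · obtain ⟨A, hA⟩ := eventually_atTop.1 (h1.eventually_ge_atTop (2 * m))
      obtain ⟨B, hB⟩ := eventually_atBot.1 (h2.eventually_lt_atBot (2 * m))
      refine ⟨(max A (-B)).toNat, Or.inl ⟨fun i hi => hA i (by omega), fun i hi => ?_⟩⟩
      exact not_le.2 (hB i (by omega))
    · obtain ⟨A, hA⟩ := eventually_atTop.1 (h1.eventually_lt_atBot (2 * m))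
      obtain ⟨B, hB⟩ := eventually_atBot.1 (h2.eventually_ge_atTop (2 * m))
      refine ⟨(max A (-B)).toNat, Or.inr ⟨fun i hi => ?_, fun i hi => hB i (by omega)⟩⟩
      exact not_le.2 (hA i (by omega))
  obtain ⟨N, ⟨h1, h2⟩ | ⟨h1, h2⟩⟩ := key
  · refine CornerPercolation.exists_escapes m N ?_ (fun i hi => ?_) (fun i hi => ?_)
    · simp [h1 N le_rfl, h2 (-N) le_rfl, -not_le]
    · simp [h1 N le_rfl, h1 i hi]
    · simp [h2 (-N) le_rfl, h2 i hi, -not_le]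
  · refine CornerPercolation.exists_escapes m N ?_ (fun i hi => ?_) (fun i hi => ?_)
    · simp [h1 N le_rfl, h2 (-N) le_rfl, -not_le]
    · simp [h1 N le_rfl, h1 i hi, -not_le]
    · simp [h2 (-N) le_rfl, h2 i hi]

lemma exists_escapes_of_hasDrift {ω : Env} (h : HasDrift ω.1 ∨ HasDrift ω.2) :
    ∃ c : ℤ, ∀ m : ℤ, ∃ v, Escapes ω v ∧ height ω v = 4 * m + c := by
  rcases h with h | h
  · refine ⟨-1 + 2 * ω.2 0, fun m => ?_⟩
    obtain ⟨v, hv, hh⟩ := h.exists_escapes m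
    exact ⟨v, hv, by rw [hh]; ring⟩
  · refine ⟨-1 + 2 * ω.1 0, fun m => ?_⟩
    obtain ⟨v, hv, hh⟩ := HasDrift.exists_escapes (ω := ω.swap) h m
    refine ⟨v.swap, hv.of_swap, ?_⟩
    have := height_swap ω v.swap
    rw [Prod.swap_swap] at this
    rw [← this, hh, Prod.snd_swap]
    ring

lemma infinite_infinitePaths {ω : Env} (h : HasDrift ω.1 ∨ HasDrift ω.2) :
    (infinitePaths ω).Infinite := by
  obtain ⟨c, hc⟩ := exists_escapes_of_hasDrift h
  choose v hv hh using hc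
  refine Set.infinite_of_injective_forall_mem (f := fun m => (graph ω).connectedComponentMk (v m))
    (fun m n hmn => ?_) fun m => (hv m).mem_infinitePaths
  have := height_eq_of_reachable (SimpleGraph.ConnectedComponent.exact hmn)
  rw [hh, hh] at this
  omega

lemma exists_even_escapes {ω : Env} (h : HasDrift ω.1 ∨ HasDrift ω.2) :
    ∃ v : ℤ × ℤ, Even (v.1 + v.2) ∧ Escapes ω v := by
  obtain ⟨c, hc⟩ := exists_escapes_of_hasDrift h
  obtain ⟨v, hv, -⟩ := hc 0
  by_cases hp : Even (v.1 + v.2)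
  · exact ⟨v, hp, hv⟩
  · exact ⟨step ω v, (even_step_iff ω v).2 hp, hv.step_apply⟩

lemma isProbabilityMeasure_signLaw {r : ℝ} (h0 : 0 ≤ r) (h1 : r ≤ 1) :
    IsProbabilityMeasure (signLaw r) := by
  refine ⟨?_⟩
  rw [signLaw, Measure.add_apply, Measure.smul_apply, Measure.smul_apply, measure_univ,
    measure_univ, smul_eq_mul, smul_eq_mul, mul_one, mul_one,
    ← ENNReal.ofReal_add h0 (sub_nonneg.2 h1)]
  simp

lemma measurable_coe_sign : Measurable fun u : ℤˣ => ((u : ℤ) : ℝ) :=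
  (measurable_of_countable fun n : ℤ => (n : ℝ)).comp (comap_measurable Units.val)

lemma integral_signLaw {r : ℝ} (h0 : 0 ≤ r) (h1 : r ≤ 1) :
    ∫ u, ((u : ℤ) : ℝ) ∂(signLaw r) = 2 * r - 1 := by
  have hi : ∀ v : ℤˣ, Integrable (fun u : ℤˣ => ((u : ℤ) : ℝ)) (Measure.dirac v) := fun v =>
    integrable_dirac' measurable_coe_sign.stronglyMeasurable (by simp)
  rw [signLaw, integral_add_measure ((hi 1).smul_measure (by simp))
    ((hi (-1)).smul_measure (by simp)), integral_smul_measure, integral_smul_measure,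
    integral_dirac' _ _ measurable_coe_sign.stronglyMeasurable,
    integral_dirac' _ _ measurable_coe_sign.stronglyMeasurable, ENNReal.toReal_ofReal h0,
    ENNReal.toReal_ofReal (sub_nonneg.2 h1)]
  simp
  ring

lemma ae_tendsto_sum_sign {r : ℝ} (h0 : 0 ≤ r) (h1 : r ≤ 1) {f : ℕ → ℤ}
    (hf : Function.Injective f) :
    ∀ᵐ ξ : ℤ → ℤˣ ∂(Measure.infinitePi fun _ : ℤ => signLaw r),
      Tendsto (fun n : ℕ => (∑ k ∈ Finset.range n, ((ξ (f k) : ℤ) : ℝ)) / n) atTop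
        (𝓝 (2 * r - 1)) := by
  have := isProbabilityMeasure_signLaw h0 h1
  set μ := Measure.infinitePi fun _ : ℤ => signLaw r
  have hm : ∀ i : ℤ, Measurable fun ξ : ℤ → ℤˣ => ((ξ i : ℤ) : ℝ) := fun i =>
    measurable_coe_sign.comp (measurable_pi_apply i)
  have hmap : ∀ i : ℤ, μ.map (fun ξ => ((ξ i : ℤ) : ℝ)) =
      (signLaw r).map fun u : ℤˣ => ((u : ℤ) : ℝ) := by
    intro i
    rw [← (measurePreserving_eval_infinitePi (fun _ : ℤ => signLaw r) i).map_eq,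
      Measure.map_map measurable_coe_sign (measurable_pi_apply i)]
    rfl
  have hind : ProbabilityTheory.iIndepFun (fun (i : ℤ) (ξ : ℤ → ℤˣ) => ((ξ i : ℤ) : ℝ)) μ :=
    ProbabilityTheory.iIndepFun_infinitePi fun _ => measurable_coe_sign
  have hint : ∫ ξ : ℤ → ℤˣ, ((ξ (f 0) : ℤ) : ℝ) ∂μ = 2 * r - 1 := by
    rw [← integral_signLaw h0 h1,
      ← (measurePreserving_eval_infinitePi (fun _ : ℤ => signLaw r) (f 0)).map_eq,
      integral_map (measurable_pi_apply _).aemeasurable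
        measurable_coe_sign.stronglyMeasurable.aestronglyMeasurable]
  have hbdd : Integrable (fun ξ : ℤ → ℤˣ => ((ξ (f 0) : ℤ) : ℝ)) μ := by
    refine Integrable.of_bound (hm _).aestronglyMeasurable 1 (ae_of_all _ fun ξ => ?_)
    rcases Int.units_eq_one_or (ξ (f 0)) with h | h <;> simp [h]
  have hid : ∀ k : ℕ, ProbabilityTheory.IdentDistrib (fun ξ : ℤ → ℤˣ => ((ξ (f k) : ℤ) : ℝ))
      (fun ξ : ℤ → ℤˣ => ((ξ (f 0) : ℤ) : ℝ)) μ μ := fun k =>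
    ⟨(hm _).aemeasurable, (hm _).aemeasurable, by rw [hmap, hmap]⟩
  have hlaw := ProbabilityTheory.strong_law_ae_real
    (fun (k : ℕ) (ξ : ℤ → ℤˣ) => ((ξ (f k) : ℤ) : ℝ)) hbdd
    (fun i j hij => hind.indepFun (hf.ne hij)) hid
  rwa [hint] at hlaw

lemma exists_linear_bound {s : ℕ → ℝ} {a : ℝ} (h : Tendsto (fun n : ℕ => s n / n) atTop (𝓝 a))
    {ε : ℝ} (hε : 0 < ε) : ∃ K : ℝ, ∀ n : ℕ, |s n - a * n| ≤ ε * n + K := by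
  obtain ⟨N, hN⟩ := eventually_atTop.1 (Metric.tendsto_nhds.1 h ε hε)
  refine ⟨∑ n ∈ Finset.range (N + 1), |s n - a * n|, fun n => ?_⟩
  have hK : 0 ≤ ∑ n ∈ Finset.range (N + 1), |s n - a * n| :=
    Finset.sum_nonneg fun _ _ => abs_nonneg _
  by_cases hn : n < N + 1
  · have := Finset.single_le_sum (f := fun n : ℕ => |s n - a * n|) (fun _ _ => abs_nonneg _)
      (Finset.mem_range.2 hn)
    have h' : 0 ≤ ε * n := by positivity
    linarith
  · have hpos : (0 : ℝ) < n := by exact_mod_cast (by omega : 0 < n)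
    have := hN n (by omega)
    rw [Real.dist_eq] at this
    have e : s n - a * n = (s n / n - a) * n := by field_simp
    rw [e, abs_mul, abs_of_pos hpos]
    nlinarith

/-- The partial sums grow linearly with the slope `a` on both sides. -/
def HasRate (ξ : ℤ → ℤˣ) (a : ℝ) : Prop :=
  ∀ ε : ℝ, 0 < ε → ∃ K : ℝ, ∀ i : ℤ, |(signSum ξ i : ℝ) - a * i| ≤ ε * |(i : ℝ)| + K

lemma ae_hasRate {r : ℝ} (h0 : 0 ≤ r) (h1 : r ≤ 1) :
    ∀ᵐ ξ : ℤ → ℤˣ ∂(Measure.infinitePi fun _ : ℤ => signLaw r), HasRate ξ (2 * r - 1) := by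
  filter_upwards [ae_tendsto_sum_sign h0 h1 (f := fun k : ℕ => (k : ℤ)) Nat.cast_injective,
    ae_tendsto_sum_sign h0 h1 (f := fun k : ℕ => -(k : ℤ) - 1) (fun a b h => by simpa using h)]
    with ξ hp hn ε hε
  obtain ⟨K, hK⟩ := exists_linear_bound hp hε
  obtain ⟨L, hL⟩ := exists_linear_bound hn hε
  refine ⟨max K L, fun i => ?_⟩
  obtain ⟨n, rfl | rfl⟩ := i.eq_nat_or_neg
  · refine le_trans ?_ ((hK n).trans ?_)
    · rw [signSum_natCast]
      push_cast
      rfl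
    · simp
  · refine le_trans ?_ ((hL n).trans ?_)
    · rw [signSum_neg_natCast, ← abs_neg]
      push_cast
      refine le_of_eq (congrArg _ ?_)
      ring
    · simp

lemma HasRate.hasDrift {ξ : ℤ → ℤˣ} {a : ℝ} (h : HasRate ξ a) (ha : a ≠ 0) : HasDrift ξ := by
  obtain ⟨K, hK⟩ := h (|a| / 2) (by positivity)
  have htop : Tendsto (fun i : ℤ => |a| / 2 * (i : ℝ)) atTop atTop :=
    tendsto_intCast_atTop_atTop.const_mul_atTop (by positivity)
  have hbot : Tendsto (fun i : ℤ => |a| / 2 * (i : ℝ)) atBot atBot :=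
    Tendsto.const_mul_atBot (by positivity) ((tendsto_intCast_atBot_iff (R := ℝ)).2 tendsto_id)
  rcases ha.lt_or_gt with ha | ha
  · rw [abs_of_neg ha] at *
    refine Or.inr ⟨?_, ?_⟩
    · rw [← tendsto_intCast_atBot_iff (R := ℝ)]
      refine tendsto_atBot_mono' _ ?_
        (tendsto_neg_atTop_atBot.comp (tendsto_atTop_add_const_right _ (-K) htop))
      filter_upwards [eventually_ge_atTop 0] with i hi
      have := abs_le.1 (hK i)
      rw [abs_of_nonneg (by exact_mod_cast hi)] at this
      simp only [Function.comp]
      linarith [this.2]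
    · rw [← tendsto_intCast_atTop_iff (R := ℝ)]
      refine tendsto_atTop_mono' _ ?_
        (tendsto_neg_atBot_atTop.comp (tendsto_atBot_add_const_right _ K hbot))
      filter_upwards [eventually_le_atBot 0] with i hi
      have := abs_le.1 (hK i)
      rw [abs_of_nonpos (by exact_mod_cast hi)] at this
      simp only [Function.comp]
      linarith [this.1]
  · rw [abs_of_pos ha] at *
    refine Or.inl ⟨?_, ?_⟩
    · rw [← tendsto_intCast_atTop_iff (R := ℝ)]
      refine tendsto_atTop_mono' _ ?_ (tendsto_atTop_add_const_right _ (-K) htop)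
      filter_upwards [eventually_ge_atTop 0] with i hi
      have := abs_le.1 (hK i)
      rw [abs_of_nonneg (by exact_mod_cast hi)] at this
      linarith [this.1]
    · rw [← tendsto_intCast_atBot_iff (R := ℝ)]
      refine tendsto_atBot_mono' _ ?_ (tendsto_atBot_add_const_right _ K hbot)
      filter_upwards [eventually_le_atBot 0] with i hi
      have := abs_le.1 (hK i)
      rw [abs_of_nonpos (by exact_mod_cast hi)] at this
      linarith [this.2]

/-- The environment seen from the vertex `v`. -/
def shift (v : ℤ × ℤ) (ω : Env) : Env := (fun i => ω.1 (i + v.1), fun j => ω.2 (j + v.2))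

lemma measurePreserving_shift {p q : ℝ} (hp0 : 0 ≤ p) (hp1 : p ≤ 1) (hq0 : 0 ≤ q) (hq1 : q ≤ 1)
    (v : ℤ × ℤ) : MeasurePreserving (shift v) (envLaw p q) (envLaw p q) := by
  have := isProbabilityMeasure_signLaw hp0 hp1
  have := isProbabilityMeasure_signLaw hq0 hq1
  have key : ∀ (r : ℝ) [IsProbabilityMeasure (signLaw r)] (a : ℤ),
      MeasurePreserving (fun (ξ : ℤ → ℤˣ) i => ξ (i + a))
        (Measure.infinitePi fun _ : ℤ => signLaw r) (Measure.infinitePi fun _ : ℤ => signLaw r) :=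
    fun r _ a => ⟨by fun_prop, Measure.map_infinitePi_infinitePi_of_inj (add_left_injective a)⟩
  exact (key q v.1).prod (key p v.2)

lemma step_shift {ω : Env} {v : ℤ × ℤ} (hv : Even (v.1 + v.2)) (u : ℤ × ℤ) :
    step (shift v ω) u + v = step ω (u + v) := by
  have : Even ((u + v).1 + (u + v).2) ↔ Even (u.1 + u.2) := by
    rw [Prod.fst_add, Prod.snd_add, add_add_add_comm, Int.even_add]
    simp [hv]
  by_cases hu : Even (u.1 + u.2)
  · rw [step_of_even hu, step_of_even (this.2 hu)]
    ext <;> simp [shift]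
    ring
  · rw [step_of_not_even hu, step_of_not_even (mt this.1 hu)]
    ext <;> simp [shift]
    ring

lemma Escapes.shift {ω : Env} {v : ℤ × ℤ} (hv : Even (v.1 + v.2)) (h : Escapes ω v) :
    Escapes (shift v ω) (0, 0) := by
  have key : ∀ (n : ℕ) (u : ℤ × ℤ),
      (step (CornerPercolation.shift v ω) ^ n) u + v = (step ω ^ n) (u + v) := by
    intro n
    induction n with
    | zero => simp
    | succ n ih =>
      intro u
      rw [pow_succ, pow_succ, Equiv.Perm.mul_apply, Equiv.Perm.mul_apply, ih, step_shift hv]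
  intro n hn e
  refine h n hn ?_
  have := key n (0, 0)
  rw [e] at this
  rw [← Prod.zero_eq_mk, zero_add] at this
  exact this.symm

lemma ae_hasRate_env {p q : ℝ} (hp0 : 0 ≤ p) (hp1 : p ≤ 1) (hq0 : 0 ≤ q) (hq1 : q ≤ 1) :
    ∀ᵐ ω ∂(envLaw p q), HasRate ω.1 (2 * q - 1) ∧ HasRate ω.2 (2 * p - 1) := by
  have := isProbabilityMeasure_signLaw hp0 hp1
  have := isProbabilityMeasure_signLaw hq0 hq1
  exact (Measure.quasiMeasurePreserving_fst.ae (ae_hasRate hq0 hq1)).and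
    (Measure.quasiMeasurePreserving_snd.ae (ae_hasRate hp0 hp1))

lemma envLaw_escapes_pos {p q : ℝ} (hp0 : 0 ≤ p) (hp1 : p ≤ 1) (hq0 : 0 ≤ q) (hq1 : q ≤ 1)
    (h : ∀ᵐ ω ∂(envLaw p q), HasDrift ω.1 ∨ HasDrift ω.2) :
    0 < envLaw p q {ω | Escapes ω (0, 0)} := by
  have := isProbabilityMeasure_signLaw hp0 hp1
  have := isProbabilityMeasure_signLaw hq0 hq1
  have : IsProbabilityMeasure (envLaw p q) := by unfold envLaw; infer_instance
  refine pos_iff_ne_zero.2 fun h0 => ?_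
  have hne : ∀ᵐ ω ∂(envLaw p q), ∀ v : ℤ × ℤ, ¬ Escapes (shift v ω) (0, 0) := by
    refine ae_all_iff.2 fun v => ?_
    refine (measurePreserving_shift hp0 hp1 hq0 hq1 v).quasiMeasurePreserving.ae
      (p := fun ω => ¬ Escapes ω (0, 0)) ?_
    rw [ae_iff]
    simpa using h0
  obtain ⟨ω, hω, hω'⟩ := (h.and hne).exists
  obtain ⟨v, hv, hv'⟩ := exists_even_escapes hω
  exact hω' v (hv'.shift hv)

lemma abs_le_sqrt_sq_add_sq (x y : ℝ) : |x| ≤ √(x ^ 2 + y ^ 2) :=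
  Real.abs_le_sqrt (by nlinarith [sq_nonneg y])

lemma supp_subset_disk_union_cone {ω : Env} {p q : ℝ} (h1 : HasRate ω.1 (2 * q - 1))
    (h2 : HasRate ω.2 (2 * p - 1)) (hpq : (p, q) ≠ (1 / 2, 1 / 2))
    (C : (graph ω).ConnectedComponent) {ε : ℝ} (hε : 0 < ε) :
    ∃ R : ℝ, 0 < R ∧ C.supp ⊆ disk R ∪ cone p q ε := by
  obtain ⟨u, rfl⟩ := C.exists_rep
  set z := √((2 * q - 1) ^ 2 + (2 * p - 1) ^ 2) with hz
  have hzpos : 0 < z := by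
    refine Real.sqrt_pos.2 ?_
    by_contra hle
    have hq : 2 * q - 1 = 0 := by nlinarith [sq_nonneg (2 * q - 1), sq_nonneg (2 * p - 1)]
    have hp : 2 * p - 1 = 0 := by nlinarith [sq_nonneg (2 * q - 1), sq_nonneg (2 * p - 1)]
    exact hpq (Prod.ext (by simp; linarith) (by simp; linarith))
  obtain ⟨K, hK⟩ := h1 (ε * z / 4) (by positivity)
  obtain ⟨L, hL⟩ := h2 (ε * z / 4) (by positivity)
  set M : ℝ := K + L + |(height ω u : ℝ)| / 2 + 3 / 2 with hM
  refine ⟨max 1 (M / (ε * z / 2)), by positivity, fun v hv => ?_⟩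
  rw [Set.mem_union, or_iff_not_imp_left]
  intro hd
  simp only [disk, Set.mem_ofPred_eq, not_le] at hd
  have hh : height ω v = height ω u :=
    height_eq_of_reachable (SimpleGraph.ConnectedComponent.exact hv).symm
  have hb := abs_height_sub_le ω v
  rw [hh] at hb
  have hb' : |(height ω u : ℝ) - 2 * (signSum ω.1 v.1 + signSum ω.2 v.2)| ≤ 3 := by
    exact_mod_cast hb
  change |(2 * q - 1) * (v.1 : ℝ) + (2 * p - 1) * (v.2 : ℝ)| ≤
    ε * z * √((v.1 : ℝ) ^ 2 + (v.2 : ℝ) ^ 2)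
  have hx := abs_le_sqrt_sq_add_sq (v.1 : ℝ) v.2
  have hy := abs_le_sqrt_sq_add_sq (v.2 : ℝ) v.1
  rw [add_comm] at hy
  set N := √((v.1 : ℝ) ^ 2 + (v.2 : ℝ) ^ 2)
  have hN : M ≤ ε * z / 2 * N := by
    have := (le_max_right 1 (M / (ε * z / 2))).trans hd.le
    rwa [div_le_iff₀' (by positivity)] at this
  have hx' : ε * z / 4 * |(v.1 : ℝ)| ≤ ε * z / 4 * N := by gcongr
  have hy' : ε * z / 4 * |(v.2 : ℝ)| ≤ ε * z / 4 * N := by gcongr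
  have hKv := abs_le.1 (hK v.1)
  have hLv := abs_le.1 (hL v.2)
  have hbv := abs_le.1 hb'
  have hhu := abs_le.1 (le_refl |(height ω u : ℝ)|)
  rw [abs_le]
  constructor <;> linarith [hKv.1, hKv.2, hLv.1, hLv.2, hbv.1, hbv.2, hhu.1, hhu.2]

lemma finite_disk (R : ℝ) : (disk R).Finite := by
  refine ((Set.finite_Icc (-⌈R⌉) ⌈R⌉).prod (Set.finite_Icc (-⌈R⌉) ⌈R⌉)).subset fun v hv => ?_
  have hx := (abs_le_sqrt_sq_add_sq (v.1 : ℝ) v.2).trans hv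
  have hy := abs_le_sqrt_sq_add_sq (v.2 : ℝ) v.1
  rw [add_comm] at hy
  have hx' := abs_le.1 (hx.trans (Int.le_ceil R))
  have hy' := abs_le.1 ((hy.trans hv).trans (Int.le_ceil R))
  exact ⟨⟨by exact_mod_cast hx'.1, by exact_mod_cast hx'.2⟩,
    by exact_mod_cast hy'.1, by exact_mod_cast hy'.2⟩

lemma eventually_ne_zero_and_tendsto_div {ι : Type*} {l : Filter ι} {a b : ℝ} (hb : b ≠ 0)
    {x y : ι → ℝ} (h0 : ∀ᶠ n in l, x n ≠ 0 ∨ y n ≠ 0)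
    (h : ∀ δ : ℝ, 0 < δ → ∀ᶠ n in l, |a * x n + b * y n| ≤ δ * (|x n| + |y n|)) :
    (∀ᶠ n in l, x n ≠ 0) ∧ Tendsto (fun n => y n / x n) l (𝓝 (-a / b)) := by
  have hb' : 0 < |b| := abs_pos.2 hb
  have hne : ∀ᶠ n in l, x n ≠ 0 := by
    filter_upwards [h0, h (|b| / 2) (by positivity)] with n hn hd hx
    rcases hn with hn | hn
    · exact hn hx
    · rw [hx, mul_zero, zero_add, abs_zero, zero_add, abs_mul] at hd
      have : 0 < |b| * |y n| := by positivity
      linarith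
  refine ⟨hne, Metric.tendsto_nhds.2 fun ε hε => ?_⟩
  set M : ℝ := 1 + (2 * |a| + |b|) / |b| with hM
  have hMpos : 0 < M := by positivity
  filter_upwards [hne, h (|b| / 2) (by positivity), h (|b| * (ε / 2) / M) (by positivity)]
    with n hx h1 h2
  have hxp : 0 < |x n| := abs_pos.2 hx
  have hy : |x n| + |y n| ≤ M * |x n| := by
    have h3 : |b| * |y n| ≤ |a * x n + b * y n| + |a| * |x n| := by
      rw [← abs_mul, ← abs_mul]
      calc |b * y n| = |(a * x n + b * y n) - a * x n| := by ring_nf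
        _ ≤ _ := abs_sub _ _
    have h4 : |b| * |y n| ≤ (2 * |a| + |b|) * |x n| := by linarith
    have h5 : |y n| ≤ (2 * |a| + |b|) / |b| * |x n| := by
      rw [div_mul_eq_mul_div, le_div_iff₀' hb']
      exact h4
    rw [hM]
    linarith
  have e : y n / x n - -a / b = (a * x n + b * y n) / (b * x n) := by
    field_simp
    ring
  rw [Real.dist_eq, e, abs_div, abs_mul, div_lt_iff₀ (by positivity)]
  calc |a * x n + b * y n| ≤ |b| * (ε / 2) / M * (|x n| + |y n|) := h2
    _ ≤ |b| * (ε / 2) / M * (M * |x n|) := by gcongr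
    _ = ε / 2 * (|b| * |x n|) := by field_simp
    _ < ε * (|b| * |x n|) := by
      have : 0 < |b| * |x n| := by positivity
      nlinarith

lemma hasSlope_of_rate {ω : Env} {p q : ℝ} (h1 : HasRate ω.1 (2 * q - 1))
    (h2 : HasRate ω.2 (2 * p - 1)) (hpq : (p, q) ≠ (1 / 2, 1 / 2))
    {C : (graph ω).ConnectedComponent} {γ : ℤ → ℤ × ℤ} (hγ : IsBiinfinitePath C γ)
    {l : Filter ℤ} (hl : l ≤ cofinite) :
    (p ≠ 1 / 2 → HasSlope γ l ((2 * q - 1) / (1 - 2 * p))) ∧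
      (p = 1 / 2 → HasInfiniteSlope γ l) := by
  obtain ⟨hinj, -, hrange⟩ := hγ
  have hout : ∀ R, ∀ᶠ n in l, γ n ∉ disk R := fun R =>
    (hinj.tendsto_cofinite.mono_left hl).eventually (finite_disk R).eventually_cofinite_notMem
  have hcone : ∀ ε : ℝ, 0 < ε → ∀ᶠ n in l, γ n ∈ cone p q ε := by
    intro ε hε
    obtain ⟨R, -, hR⟩ := supp_subset_disk_union_cone h1 h2 hpq C hε
    filter_upwards [hout R] with n hn
    exact (hR (hrange ▸ Set.mem_range_self n)).resolve_left hn
  have hne : ∀ᶠ n in l, ((γ n).1 : ℝ) ≠ 0 ∨ ((γ n).2 : ℝ) ≠ 0 := by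
    filter_upwards [hout 0] with n hn
    by_contra! hz
    exact hn (by simp [disk, hz.1, hz.2])
  have hδ : ∀ δ : ℝ, 0 < δ → ∀ᶠ n in l,
      |(2 * q - 1) * ((γ n).1 : ℝ) + (2 * p - 1) * ((γ n).2 : ℝ)| ≤
      δ * (|((γ n).1 : ℝ)| + |((γ n).2 : ℝ)|) := by
    intro δ hδ
    set z := √((2 * q - 1) ^ 2 + (2 * p - 1) ^ 2) with hz
    have hz0 : 0 ≤ z := Real.sqrt_nonneg _
    filter_upwards [hcone (δ / (z + 1)) (by positivity)] with n hn
    refine le_trans hn ?_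
    rw [← hz]
    refine mul_le_mul ?_ ?_ (Real.sqrt_nonneg _) hδ.le
    · rw [div_mul_eq_mul_div, div_le_iff₀ (by positivity)]
      nlinarith
    · rw [Real.sqrt_le_left (by positivity)]
      nlinarith [abs_nonneg ((γ n).1 : ℝ), abs_nonneg ((γ n).2 : ℝ), sq_abs ((γ n).1 : ℝ),
        sq_abs ((γ n).2 : ℝ), mul_nonneg (abs_nonneg ((γ n).1 : ℝ)) (abs_nonneg ((γ n).2 : ℝ))]
  refine ⟨fun hp => ?_, fun hp => ?_⟩
  · have hb : 2 * p - 1 ≠ 0 := fun h => hp (by linarith)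
    obtain ⟨h3, h4⟩ := eventually_ne_zero_and_tendsto_div hb hne hδ
    refine ⟨h3.mono fun n hn => by exact_mod_cast hn, ?_⟩
    rwa [← neg_div_neg_eq, neg_neg, neg_sub] at h4
  · have hb : 2 * q - 1 ≠ 0 := fun h => hpq (Prod.ext hp (by simp; linarith))
    obtain ⟨h3, h4⟩ := eventually_ne_zero_and_tendsto_div (a := 2 * p - 1) hb
      (hne.mono fun n => Or.symm)
      (fun δ hd => (hδ δ hd).mono fun n hn => by rwa [add_comm, add_comm |((γ n).2 : ℝ)|])
    refine ⟨h3.mono fun n hn => by exact_mod_cast hn, ?_⟩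
    simpa [hp] using h4

end CornerPercolation

open CornerPercolation in
theorem theorem1 (p q : ℝ) (hp0 : 0 < p) (hp1 : p < 1) (hq0 : 0 < q) (hq1 : q < 1)
    (hpq : (p, q) ≠ (1 / 2, 1 / 2)) :
    -- with positive probability, the path from the origin never returns and is infinite
    0 < envLaw p q {ω | (∀ n : ℕ, 1 ≤ n → walk ω n ≠ (0, 0)) ∧
      (graph ω).connectedComponentMk (0, 0) ∈ infinitePaths ω} ∧
    -- almost surely, there are infinitely many infinite paths
    (∀ᵐ ω ∂(envLaw p q), (infinitePaths ω).Infinite) ∧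
    -- almost surely, every path is in the cone, up to a bounded part, for all cones
    (∀ᵐ ω ∂(envLaw p q), ∀ C : (graph ω).ConnectedComponent, ∀ ε : ℝ, 0 < ε →
      ∃ R : ℝ, 0 < R ∧ C.supp ⊆ disk R ∪ cone p q ε) ∧
    -- almost surely, both ends of every infinite path have the same asymptotic slope
    (∀ᵐ ω ∂(envLaw p q), ∀ C : (graph ω).ConnectedComponent, ∀ γ : ℤ → ℤ × ℤ,
      IsBiinfinitePath C γ →
        (p ≠ 1 / 2 → HasSlope γ atTop ((2 * q - 1) / (1 - 2 * p)) ∧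
          HasSlope γ atBot ((2 * q - 1) / (1 - 2 * p))) ∧
        (p = 1 / 2 → HasInfiniteSlope γ atTop ∧ HasInfiniteSlope γ atBot)) := by
  have hrate := ae_hasRate_env hp0.le hp1.le hq0.le hq1.le
  have hdrift : ∀ᵐ ω ∂(envLaw p q), HasDrift ω.1 ∨ HasDrift ω.2 := by
    filter_upwards [hrate] with ω hω
    by_cases hq : 2 * q - 1 = 0
    · refine Or.inr (hω.2.hasDrift fun hp => hpq (Prod.ext ?_ ?_)) <;> simp <;> linarith
    · exact Or.inl (hω.1.hasDrift hq)
  refine ⟨?_, ?_, ?_, ?_⟩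
  · refine (envLaw_escapes_pos hp0.le hp1.le hq0.le hq1.le hdrift).trans_le (measure_mono ?_)
    exact fun ω hω => ⟨fun n hn => (walk_eq_step_pow ω n).1 ▸ hω n hn, Escapes.mem_infinitePaths hω⟩
  · filter_upwards [hdrift] with ω hω using infinite_infinitePaths hω
  · filter_upwards [hrate] with ω hω C ε hε
    exact supp_subset_disk_union_cone hω.1 hω.2 hpq C hε
  · filter_upwards [hrate] with ω hω C γ hγ
    have htop := hasSlope_of_rate hω.1 hω.2 hpq hγ (l := atTop) (Int.cofinite_eq ▸ le_sup_right)
    have hbot := hasSlope_of_rate hω.1 hω.2 hpq hγ (l := atBot) (Int.cofinite_eq ▸ le_sup_left)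
    exact ⟨fun h => ⟨htop.1 h, hbot.1 h⟩, fun h => ⟨htop.2 h, hbot.2 h⟩⟩
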